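/- **Definitions.** The Legendre–Stirling numbers of the second kind $LS(n,k)$ $(0\le k\le n)$ are the integers determined by $$x^n=\sum_{k=0}^{n}LS(n,k)\prod_{i=0}^{k-1}\bigl(x-i(i+1)\bigr).$$ For $k\ge 1$ let $P_k$ be the poset on the $3k$ points labeled $1,2,\dots,3k$ whose covering relations are $3m-2<3m-1$ and $3m<3m-1$ for $1\le m\le k$, and $3m-1<3m+2$ for $1\le m<k$. A linear extension of $P_k$ is identified with the word obtained by listing the labels of the points in increasing order with respect to the extension. The number of descents of a word $\pi=\pi_1\pi_2\cdots\pi_m$ on a (pre)ordered alphabet is the number of $l$ with $1\le l\le m-1$ and $\pi_l>\pi_{l+1}$. Let $b_{k,j}$ be the number of linear extensions of $P_k$ with exactly $j$ descents. Let $M_k$ be the multiset $\{1,1,\bar 1,2,2,\bar 2,\dots,k,k,\bar k\}$, where $m$ and $\bar m$ are different symbols, and compare the letters by $\bar 1=1<\bar 2=2<\cdots<\bar k=k$ (so neither $m\bar m$ nor $\bar m m$ is a descent). A Legendre–Stirling permutation of $M_k$ is a permutation $\pi$ of the multiset $M_k$ such that, whenever $u<v<w$ and $\pi(u)$ and $\pi(w)$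 are the same symbol, $\pi(v)>\pi(u)$ in this order. **Theorem (Egge).** Let $k\ge 1$. For every $j\ge 1$, the number $b_{k,j}$ equals the number of Legendre–Stirling permutations of $M_k$ with exactly $j-1$ descents. Here the $b_{k,j}$ are the coefficients in $$\sum_{n\ge 0}LS(n+k,n)\,t^n=\frac{\sum_{j=1}^{2k-1}b_{k,j}\,t^j}{(1-t)^{3k+1}}$$ (an identity of formal power series, which is part of the assertion). -/

import Mathlib

namespace LegendreStirling

/-! ### Jacobi-Stirling and Legendre-Stirling numbers of the second kind -/

/-- The Jacobi-Stirling numbers of the second kind `JS(n, k; z)`, by their triangular recurrence.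
They are the connection coefficients characterised by `pow_eq_sum_jacobiStirling` and
`jacobiStirling_unique` below. -/
def jacobiStirling {R : Type*} [CommRing R] (z : R) : ℕ → ℕ → R
  | 0, 0 => 1
  | 0, _ + 1 => 0
  | _ + 1, 0 => 0
  | n + 1, k + 1 =>
      jacobiStirling z n k + ((k + 1 : ℕ) : R) * (((k + 1 : ℕ) : R) + z) *
        jacobiStirling z n (k + 1)

/-- The Legendre-Stirling numbers of the second kind, `LS(n, k) = JS(n, k; 1)`. -/
def legendreStirling (n k : ℕ) : ℤ := jacobiStirling (1 : ℤ) n k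

theorem jacobiStirling_eq_zero {R : Type*} [CommRing R] (z : R) :
    ∀ n k : ℕ, n < k → jacobiStirling z n k = 0
  | 0, 0, h => absurd h (by omega)
  | 0, _ + 1, _ => rfl
  | _ + 1, 0, h => absurd h (by omega)
  | n + 1, k + 1, h => by
      rw [jacobiStirling, jacobiStirling_eq_zero z n k (by omega),
        jacobiStirling_eq_zero z n (k + 1) (by omega)]
      simp

/-- The polynomial `∏_{i=0}^{k-1} (x - i(z+i))`. -/
noncomputable def basisPoly {R : Type*} [CommRing R] (z : R) (k : ℕ) : Polynomial R :=
  ∏ i ∈ Finset.range k, (Polynomial.X - Polynomial.C ((i : R) * (z + (i : R))))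

/-- The connection formula `x^n = ∑_{k=0}^n JS(n,k;z) ∏_{i=0}^{k-1} (x - i(z+i))`. -/
theorem pow_eq_sum_jacobiStirling {R : Type*} [CommRing R] (z : R) (n : ℕ) :
    (Polynomial.X : Polynomial R) ^ n =
      ∑ k ∈ Finset.range (n + 1), Polynomial.C (jacobiStirling z n k) * basisPoly z k := by
  induction n with
  | zero => simp [jacobiStirling, basisPoly]
  | succ n ih =>
    have hX : ∀ k : ℕ, (Polynomial.X : Polynomial R) * basisPoly z k = basisPoly z (k + 1) +
        Polynomial.C ((k : R) * ((k : R) + z)) * basisPoly z k := by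
      intro k
      simp only [basisPoly, Finset.prod_range_succ, map_mul, map_add]
      ring
    have h0 : jacobiStirling z (n + 1) 0 = 0 := rfl
    have hs : ∀ k, jacobiStirling z (n + 1) (k + 1) = jacobiStirling z n k +
        ((k + 1 : ℕ) : R) * (((k + 1 : ℕ) : R) + z) * jacobiStirling z n (k + 1) :=
      fun k => by rw [jacobiStirling]
    have e : ∑ k ∈ Finset.range (n + 1), Polynomial.C (jacobiStirling z n k) *
          (Polynomial.C ((k : R) * ((k : R) + z)) * basisPoly z k) =
        ∑ k ∈ Finset.range (n + 1), Polynomial.C (jacobiStirling z n (k + 1)) *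
          (Polynomial.C (((k + 1 : ℕ) : R) * (((k + 1 : ℕ) : R) + z)) * basisPoly z (k + 1)) := by
      have h1 := Finset.sum_range_succ (fun k => Polynomial.C (jacobiStirling z n k) *
          (Polynomial.C ((k : R) * ((k : R) + z)) * basisPoly z k)) (n + 1)
      have h2 := Finset.sum_range_succ' (fun k => Polynomial.C (jacobiStirling z n k) *
          (Polynomial.C ((k : R) * ((k : R) + z)) * basisPoly z k)) (n + 1)
      rw [jacobiStirling_eq_zero z n (n + 1) (by omega)] at h1
      simp only [map_zero, zero_mul, add_zero, Nat.cast_zero, mul_zero] at h1 h2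
      rw [← h1, h2]
    rw [pow_succ', ih, Finset.mul_sum, Finset.sum_range_succ' _ (n + 1), h0, map_zero, zero_mul,
      add_zero]
    calc ∑ k ∈ Finset.range (n + 1),
          Polynomial.X * (Polynomial.C (jacobiStirling z n k) * basisPoly z k)
        = ∑ k ∈ Finset.range (n + 1), Polynomial.C (jacobiStirling z n k) * basisPoly z (k + 1) +
          ∑ k ∈ Finset.range (n + 1), Polynomial.C (jacobiStirling z n k) *
            (Polynomial.C ((k : R) * ((k : R) + z)) * basisPoly z k) := by
          rw [← Finset.sum_add_distrib]
          refine Finset.sum_congr rfl fun k _ => ?_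
          rw [mul_left_comm, hX]
          ring
      _ = _ := by
          rw [e, ← Finset.sum_add_distrib]
          refine Finset.sum_congr rfl fun k _ => ?_
          rw [hs]
          simp only [map_add, map_mul]
          ring

/-- The connection formula determines the Jacobi-Stirling numbers. -/
theorem jacobiStirling_unique {R : Type*} [CommRing R] (z : R) (n : ℕ) (c : ℕ → R)
    (hc : (Polynomial.X : Polynomial R) ^ n =
      ∑ k ∈ Finset.range (n + 1), Polynomial.C (c k) * basisPoly z k) :
    ∀ k ≤ n, c k = jacobiStirling z n k := by
  nontriviality R
  have hmon : ∀ k, (basisPoly z k).Monic := fun k =>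
    Polynomial.monic_prod_of_monic _ _ fun i _ => Polynomial.monic_X_sub_C _
  have hdeg : ∀ k, (basisPoly z k).natDegree = k := fun k => by
    rw [basisPoly, Polynomial.natDegree_prod_of_monic _ _ fun i _ => Polynomial.monic_X_sub_C _]
    simp only [Polynomial.natDegree_X_sub_C, Finset.sum_const, Finset.card_range, smul_eq_mul,
      mul_one]
  have key : ∀ (m : ℕ) (d : ℕ → R),
      ∑ k ∈ Finset.range m, Polynomial.C (d k) * basisPoly z k = 0 → ∀ k < m, d k = 0 := by
    intro m
    induction m with
    | zero => intro d _ k hk; omega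
    | succ m ih =>
      intro d hd
      have hm : d m = 0 := by
        have h := congrArg (fun p => Polynomial.coeff p m) hd
        simp only [Polynomial.finsetSum_coeff, Polynomial.coeff_C_mul, Polynomial.coeff_zero] at h
        rw [Finset.sum_range_succ, Finset.sum_eq_zero, zero_add] at h
        · have h1 : (basisPoly z m).coeff m = 1 := by
            have := (hmon m).coeff_natDegree
            rwa [hdeg] at this
          simpa [h1] using h
        · intro k hk
          rw [Polynomial.coeff_eq_zero_of_natDegree_lt, mul_zero]
          rw [hdeg]
          exact Finset.mem_range.1 hk
      intro k hk
      rcases Nat.lt_succ_iff_lt_or_eq.1 hk with h | rfl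
      · refine ih d ?_ k h
        rw [Finset.sum_range_succ, hm] at hd
        simpa using hd
      · exact hm
  intro k hk
  have := key (n + 1) (fun k => c k - jacobiStirling z n k) (by
    simp only [map_sub, sub_mul, Finset.sum_sub_distrib]
    rw [← hc, ← pow_eq_sum_jacobiStirling, sub_self]) k (by omega)
  exact sub_eq_zero.1 this

/-! ### Words and descents -/

/-- The number of descents of a word `π₁π₂…π_m`: the number of adjacent pairs `(π_l, π_{l+1})` with
`π_l > π_{l+1}`. -/
def des {α : Type*} [LT α] [DecidableLT α] (w : List α) : ℕ :=
  (w.zip w.tail).countP fun p => decide (p.2 < p.1)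

/-! ### The Legendre-Stirling posets and their linear extensions -/

/-- The underlying set of the poset `P_k`: the points with labels `3m-2, 3m-1, 3m`, where
`m = block + 1` and `pos = 0, 1, 2` respectively. -/
@[ext]
structure LSPoset (k : ℕ) where
  block : Fin k
  pos : Fin 3

/-- The partial order of `P_k`. Its covering relations are `3m-2 < 3m-1`, `3m < 3m-1` and
`3m-1 < 3m+2`, so a point lies strictly above others only if it is some `3m-1`, and then it lies
above all points of the blocks `1, …, m`. -/
instance (k : ℕ) : PartialOrder (LSPoset k) where
  le x y := x = y ∨ (y.pos = 1 ∧ x.block ≤ y.block)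
  le_refl x := Or.inl rfl
  le_trans x y z hxy hyz := by
    rcases hxy with rfl | ⟨_, h2⟩
    · exact hyz
    · rcases hyz with rfl | ⟨h3, h4⟩
      · exact Or.inr ⟨by assumption, h2⟩
      · exact Or.inr ⟨h3, h2.trans h4⟩
  le_antisymm x y hxy hyx := by
    rcases hxy with h | ⟨h1, h2⟩
    · exact h
    · rcases hyx with h | ⟨h3, h4⟩
      · exact h.symm
      · exact LSPoset.ext (le_antisymm h2 h4) (h3.trans h1.symm)

/-- The labeling of `P_k` by `1, …, 3k`. -/
def LSPoset.label {k : ℕ} (x : LSPoset k) : ℕ := 3 * (x.block : ℕ) + (x.pos : ℕ) + 1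

/-- A linear extension of a finite poset, as the list of all its elements in increasing order:
each element occurs exactly once, and no element is preceded by a larger one. -/
def IsLinearExtension {α : Type*} [PartialOrder α] (w : List α) : Prop :=
  w.Nodup ∧ (∀ x : α, x ∈ w) ∧ w.Pairwise fun a b => ¬ b < a

/-- `b_{k,j}`: the number of linear extensions of `P_k` whose word of labels has exactly `j`
descents. -/
noncomputable def b (k j : ℕ) : ℕ :=
  Set.ncard {w : List (LSPoset k) | IsLinearExtension w ∧ des (w.map LSPoset.label) = j}

/-! ### Legendre-Stirling permutations -/

/-- The letters `m` (`barred = false`) and `m̄` (`barred = true`). -/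
@[ext]
structure Letter where
  val : ℕ
  barred : Bool

/-- The letters are compared through `1̄ = 1 < 2̄ = 2 < ⋯`, which is a preorder:
`m` and `m̄` are different symbols, neither of which is smaller than the other. -/
instance : Preorder Letter := Preorder.lift Letter.val

instance : DecidableLT Letter := fun x y => inferInstanceAs (Decidable (x.val < y.val))

/-- The multiset `M_k = {1, 1, 1̄, 2, 2, 2̄, …, k, k, k̄}`. -/
def M (k : ℕ) : Multiset Letter :=
  ∑ m ∈ Finset.Icc 1 k, {⟨m, false⟩, ⟨m, false⟩, ⟨m, true⟩}

/-- The defining condition of Jacobi-Stirling permutations: if `u < v < w` and `π(u) = π(w)`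
(the same symbol twice), then `π(v) > π(u)`. -/
def StirlingCondition {α : Type*} [LT α] (π : List α) : Prop :=
  ∀ u v w : Fin π.length, u < v → v < w → π.get u = π.get w → π.get u < π.get v

/-- A Legendre-Stirling permutation of `M_k`: a permutation of the multiset `M_k` that satisfies the
Jacobi-Stirling condition with respect to the order `1̄ = 1 < 2̄ = 2 < ⋯ < k̄ = k`. -/
def IsLegendreStirlingPerm (k : ℕ) (π : List Letter) : Prop :=
  (π : Multiset Letter) = M k ∧ StirlingCondition π

end LegendreStirling

/-! Linear extensions of `P_{k+1}` and Legendre–Stirling permutations of `M (k+1)` both arise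
uniquely from objects of size `k` by inserting largest letters, and inserting a block of a largest
letter changes the descent number in a controlled way (`sum_des_insertions`).

For linear extensions, `3k+1` goes into any gap, then `3k+3` into any gap, then `3k+2` to the end
(`isLabelWord_succ`). For permutations, the barred letter goes into any gap, then the two unbarred
copies go together into any gap (`isLegendreStirlingPerm_succ`). Descent distributions are handled
by summing an arbitrary test function `φ` of the descent number. In this form both constructions act
on `φ` by the same `descentOperator k`, once descents of permutations are counted with a shift of
one. Induction gives the equidistribution `sum_labelWords_eq`.

For the series, the triangular recurrence says that `F_k = ∑ LS(n+k,n) tⁿ` satisfies `(1-t) F_{k+1}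
= t (t F_k)''`. On numerators over `(1-t)^(3k+1)` this becomes `numeratorOperator`, which acts on
the powers of `t` by the same `descentOperator k` (`numeratorOperator_X_pow`). The numerator is
therefore the descent polynomial of the linear extensions. -/

namespace LegendreStirling

/-! ### Inserting a block into the gaps of a word -/

section Insertions

variable {α β R : Type*}

/-- All words obtained from `w` by inserting the block `s` into one of the gaps of `w`. -/
def insertions (s : List α) : List α → List (List α)
  | [] => [s]
  | y :: w => (s ++ y :: w) :: (insertions s w).map (List.cons y)

theorem mem_insertions {s w u : List α} :
    u ∈ insertions s w ↔ ∃ p q, w = p ++ q ∧ u = p ++ s ++ q := by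
  induction w generalizing u with
  | nil =>
    simp only [insertions, List.mem_singleton]
    constructor
    · rintro rfl
      exact ⟨[], [], by simp⟩
    · rintro ⟨p, q, h, rfl⟩
      obtain ⟨rfl, rfl⟩ := List.append_eq_nil_iff.1 h.symm
      simp
  | cons y w ih =>
    simp only [insertions, List.mem_cons, List.mem_map, ih]
    constructor
    · rintro (rfl | ⟨_, ⟨p, q, rfl, rfl⟩, rfl⟩)
      · exact ⟨[], y :: w, by simp⟩
      · exact ⟨y :: p, q, by simp⟩
    · rintro ⟨p, q, h, rfl⟩
      rcases p with _ | ⟨z, p⟩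
      · left
        simp_all
      · obtain ⟨rfl, rfl⟩ := List.cons.inj h
        exact Or.inr ⟨p ++ s ++ q, ⟨p, q, rfl, rfl⟩, by simp⟩

theorem map_insertions (f : α → β) (s w : List α) :
    (insertions s w).map (List.map f) = insertions (s.map f) (w.map f) := by
  induction w with
  | nil => simp [insertions]
  | cons y w ih => simp [insertions, ← ih, Function.comp_def]

/-- The gap can be recovered as the position of the first `c`. -/
theorem nodup_insertions {c : α} {s w : List α} (hc : c ∉ w) : (insertions (c :: s) w).Nodup := by
  induction w with
  | nil => simp [insertions]
  | cons y w ih =>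
    rw [List.mem_cons, not_or] at hc
    rw [insertions, List.nodup_cons]
    refine ⟨?_, (ih hc.2).map (List.cons_injective)⟩
    rw [List.mem_map]
    rintro ⟨u, -, h⟩
    exact hc.1 (List.cons.inj h).1.symm

theorem filter_of_mem_insertions [DecidableEq α] {c : α} {s w u : List α} (hs : ∀ x ∈ s, x = c)
    (hc : c ∉ w) (hu : u ∈ insertions s w) : u.filter (· ≠ c) = w := by
  obtain ⟨p, q, rfl, rfl⟩ := mem_insertions.1 hu
  rw [List.mem_append, not_or] at hc
  have h1 : p.filter (· ≠ c) = p := List.filter_eq_self.2 fun x hx => by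
    simpa using ne_of_mem_of_not_mem hx hc.1
  have h2 : q.filter (· ≠ c) = q := List.filter_eq_self.2 fun x hx => by
    simpa using ne_of_mem_of_not_mem hx hc.2
  have h3 : s.filter (· ≠ c) = [] := List.filter_eq_nil_iff.2 fun x hx => by
    simpa using hs x hx
  rw [List.filter_append, List.filter_append, h1, h2, h3, List.append_nil]

/-- Inserting the constant block `c … c` into all gaps of the distinct words of a list, none of
which contains `c`, yields distinct words. -/
theorem nodup_flatMap_insertions [DecidableEq α] {c : α} {s : List α} (hs : ∀ x ∈ s, x = c)
    {L : List (List α)} (hL : L.Nodup) (hc : ∀ w ∈ L, c ∉ w) :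
    (L.flatMap (insertions (c :: s))).Nodup := by
  have hs' : ∀ x ∈ c :: s, x = c := by simpa using hs
  rw [List.nodup_flatMap]
  refine ⟨fun w hw => nodup_insertions (hc w hw), hL.imp_of_mem fun {v w} hv hw hvw u h1 h2 => ?_⟩
  exact hvw ((filter_of_mem_insertions hs' (hc v hv) h1).symm.trans
    (filter_of_mem_insertions hs' (hc w hw) h2))

/-- Splits off the final gap, which is forbidden to `3k+3` because `3k+2` must stay last. -/
theorem sum_insertions_concat [AddCommMonoid R] (s w : List α) (a : α) (f : List α → R) :
    ((insertions s (w ++ [a])).map f).sum =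
      ((insertions s w).map fun u => f (u ++ [a])).sum + f (w ++ [a] ++ s) := by
  induction w generalizing f with
  | nil => simp [insertions]
  | cons y w ih =>
    have := ih fun u => f (y :: u)
    simp only [insertions, List.cons_append, List.map_cons, List.sum_cons, List.map_map,
      Function.comp_def, List.append_assoc] at this ⊢
    rw [this, add_assoc]

end Insertions

/-! ### Effect of an insertion on descents -/

section Descents

theorem des_singleton {α : Type*} [LT α] [DecidableLT α] (x : α) : des [x] = 0 := rfl

theorem des_cons_cons {α : Type*} [LT α] [DecidableLT α] (x y : α) (w : List α) :
    des (x :: y :: w) = des (y :: w) + if y < x then 1 else 0 := by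
  simp [des, List.countP_cons]

theorem des_map {α β : Type*} [LT α] [DecidableLT α] [LT β] [DecidableLT β] {f : α → β}
    (hf : ∀ x y, f x < f y ↔ x < y) (w : List α) : des (w.map f) = des w := by
  induction w with
  | nil => rfl
  | cons x w ih =>
    rcases w with _ | ⟨y, w⟩
    · rfl
    · simp only [List.map_cons] at ih ⊢
      simp only [des_cons_cons, ih, hf]

theorem des_replicate_append (r c : ℕ) (w : List ℕ) :
    des (List.replicate (r + 1) c ++ w) = des (c :: w) := by
  induction r with
  | zero => rfl
  | succ r ih =>
    rw [← ih, List.replicate_succ (n := r + 1), List.replicate_succ, List.cons_append,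
      List.cons_append, des_cons_cons]
    simp

theorem des_concat {w : List ℕ} {a : ℕ} (h : ∀ x ∈ w, x ≤ a) : des (w ++ [a]) = des w := by
  induction w with
  | nil => rfl
  | cons x w ih =>
    rcases w with _ | ⟨y, w⟩
    · have := h x (by simp)
      simp [des_cons_cons, des_singleton, this]
    · have := ih fun z hz => h z (List.mem_cons_of_mem _ hz)
      simp only [List.cons_append] at this ⊢
      rw [des_cons_cons, des_cons_cons, this]

variable {R : Type*} [CommRing R]

/-- The guard `y` makes every gap except the last an interior one, so the induction on `w` treats
them uniformly. -/
theorem sum_des_cons_insertions (φ : ℕ → R) (r c y : ℕ) (w : List ℕ) (hy : y ≤ c)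
    (h : ∀ x ∈ w, x ≤ c) :
    ((insertions (List.replicate (r + 1) c) w).map fun u => φ (des (y :: u))).sum =
      (des (y :: w) + 1 + w.count c : R) * φ (des (y :: w)) +
        (w.length - des (y :: w) - w.count c : R) * φ (des (y :: w) + 1) := by
  induction w generalizing y φ with
  | nil =>
    have h1 : des (y :: List.replicate (r + 1) c) = 0 := by
      rw [List.replicate_succ, des_cons_cons, if_neg (by omega), ← List.append_nil (List.replicate r c),
        ← List.cons_append, ← List.replicate_succ, des_replicate_append]
      rfl
    simp [insertions, h1, des_singleton]
  | cons z w ih =>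
    have hz : z ≤ c := h z (by simp)
    have h0 : des (y :: (List.replicate (r + 1) c ++ z :: w)) =
        des (z :: w) + if z < c then 1 else 0 := by
      rw [← des_cons_cons, ← des_replicate_append r c (z :: w), List.replicate_succ,
        List.cons_append, des_cons_cons y, if_neg (by omega), add_zero]
    -- For insertions beyond `z` the pair `y, z` survives; its possible descent is absorbed into the
    -- test function.
    have h1 := ih (fun d => φ (d + if z < y then 1 else 0)) z hz
      fun x hx => h x (List.mem_cons_of_mem _ hx)
    simp only [insertions, List.map_cons, List.sum_cons, List.map_map, Function.comp_def, h0]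
    simp only [des_cons_cons y z]
    rw [h1, List.count_cons]
    rcases hz.lt_or_eq with hzc | rfl
    · by_cases hzy : z < y
      · simp only [hzc, hzy, if_true, List.length_cons, beq_iff_eq, hzc.ne, if_false]
        push_cast
        ring
      · simp only [hzc, hzy, if_true, List.length_cons, beq_iff_eq, hzc.ne, if_false]
        push_cast
        ring
    · have hzy : ¬ z < y := by omega
      simp only [lt_irrefl, hzy, if_false, List.length_cons, beq_self_eq_true, if_true]
      push_cast
      ring

/-- The distribution of descents after a block of copies of a weakly largest letter is inserted:
no descent is created in the gaps which are descents, at the end of the word and in front of the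
copies of the largest letter, and one descent is created in every other gap. -/
theorem sum_des_insertions (φ : ℕ → R) (r c : ℕ) (w : List ℕ) (h : ∀ x ∈ w, x ≤ c) :
    ((insertions (List.replicate (r + 1) c) w).map fun u => φ (des u)).sum =
      (des w + 1 + w.count c : R) * φ (des w) +
        (w.length - des w - w.count c : R) * φ (des w + 1) := by
  rcases w with _ | ⟨y, w⟩
  · have h1 := des_replicate_append r c []
    rw [List.append_nil, des_singleton] at h1
    have h2 : des ([] : List ℕ) = 0 := rfl
    simp [insertions, h1, h2]
  · have hy : y ≤ c := h y (by simp)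
    simp only [insertions, List.map_cons, List.sum_cons, List.map_map, Function.comp_def]
    rw [sum_des_cons_insertions φ r c y w hy fun x hx => h x (List.mem_cons_of_mem _ hx),
      des_replicate_append, des_cons_cons, List.count_cons]
    rcases hy.lt_or_eq with hyc | rfl
    · simp only [hyc, if_true, List.length_cons, beq_iff_eq, hyc.ne, if_false]
      push_cast
      ring
    · simp only [lt_irrefl, if_false, List.length_cons, beq_self_eq_true, if_true]
      push_cast
      ring_nf

end Descents

/-- The operator describing how the insertion of the letters of the block `k + 1` acts on the
distribution of descents of the linear extensions of `P_k`. -/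
def descentOperator {R : Type*} [CommRing R] (k : ℕ) (φ : ℕ → R) (e : ℕ) : R :=
  e * (e + 1) * φ e + 2 * (e + 1) * (3 * k + 1 - e) * φ (e + 1) +
    (3 * k - e) * (3 * k + 1 - e) * φ (e + 2)

/-! ### Linear extensions as words of labels -/

section LinearExtensions

/-- The words of labels of the linear extensions of `P_k`. -/
structure IsLabelWord (k : ℕ) (w : List ℕ) : Prop where
  nodup : w.Nodup
  mem_iff : ∀ x, x ∈ w ↔ 1 ≤ x ∧ x ≤ 3 * k
  pairwise : w.Pairwise fun a b => a % 3 = 2 → a + 1 < b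

theorem LSPoset.label_injective (k : ℕ) : Function.Injective (LSPoset.label (k := k)) := by
  intro x y h
  have hx := x.pos.isLt
  have hy := y.pos.isLt
  simp only [LSPoset.label] at h
  exact LSPoset.ext (Fin.ext (by omega)) (Fin.ext (by omega))

theorem LSPoset.exists_label_eq {k n : ℕ} : (∃ x : LSPoset k, x.label = n) ↔ 1 ≤ n ∧ n ≤ 3 * k := by
  constructor
  · rintro ⟨x, rfl⟩
    have hx := x.pos.isLt
    have hy := x.block.isLt
    simp only [LSPoset.label]
    omega
  · rintro ⟨h1, h2⟩
    refine ⟨⟨⟨(n - 1) / 3, by omega⟩, ⟨(n - 1) % 3, by omega⟩⟩, ?_⟩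
    simp only [LSPoset.label]
    omega

/-- Only a middle point, with label `3m-1`, lies above others, namely the other points of blocks up
to `m`. These are exactly the other labels not exceeding `3m`, the label of `x` plus one. -/
theorem LSPoset.not_lt_iff {k : ℕ} {x y : LSPoset k} (h : x ≠ y) :
    ¬ y < x ↔ (x.label % 3 = 2 → x.label + 1 < y.label) := by
  have hle : y ≤ x ↔ (y = x ∨ (x.pos = 1 ∧ y.block ≤ x.block)) := Iff.rfl
  have hne : ¬ (x.block.val = y.block.val ∧ x.pos.val = y.pos.val) := fun h' =>
    h (LSPoset.ext (Fin.ext h'.1) (Fin.ext h'.2))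
  have hx := x.pos.isLt
  have hy := y.pos.isLt
  rw [lt_iff_le_and_ne, hle, and_iff_left h.symm, or_iff_right h.symm, Fin.ext_iff, Fin.le_def,
    LSPoset.label, LSPoset.label]
  simp only [Fin.val_one]
  omega

theorem isLabelWord_map_label {k : ℕ} {w : List (LSPoset k)} :
    IsLabelWord k (w.map LSPoset.label) ↔ IsLinearExtension w := by
  have hp : w.Nodup → ((w.map LSPoset.label).Pairwise (fun a b => a % 3 = 2 → a + 1 < b) ↔
      w.Pairwise fun a b => ¬ b < a) := fun hw => by
    rw [List.pairwise_map]
    constructor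
    · exact fun h => (h.and hw).imp fun hab => (LSPoset.not_lt_iff hab.2).2 hab.1
    · exact fun h => (h.and hw).imp fun hab => (LSPoset.not_lt_iff hab.2).1 hab.1
  constructor
  · rintro ⟨h1, h2, h3⟩
    have hw := h1.of_map
    refine ⟨hw, fun x => ?_, (hp hw).1 h3⟩
    have := (h2 x.label).2 (LSPoset.exists_label_eq.1 ⟨x, rfl⟩)
    exact (List.mem_map_of_injective (LSPoset.label_injective k)).1 this
  · rintro ⟨h1, h2, h3⟩
    refine ⟨h1.map (LSPoset.label_injective k), fun x => ?_, (hp h1).2 h3⟩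
    rw [← LSPoset.exists_label_eq, List.mem_map]
    exact ⟨fun ⟨y, _, h⟩ => ⟨y, h⟩, fun ⟨y, h⟩ => ⟨y, h2 y, h⟩⟩

theorem b_eq_ncard (k j : ℕ) : b k j = Set.ncard {w : List ℕ | IsLabelWord k w ∧ des w = j} := by
  rw [b, ← Set.ncard_image_of_injective _ (List.map_injective_iff.2 (LSPoset.label_injective k))]
  congr 1
  ext w
  simp only [Set.mem_image, Set.mem_ofPred_eq]
  constructor
  · rintro ⟨w, ⟨h1, h2⟩, rfl⟩
    exact ⟨isLabelWord_map_label.2 h1, h2⟩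
  · rintro ⟨h1, h2⟩
    have : w ∈ Set.range (List.map (LSPoset.label (k := k))) := by
      rw [Set.range_list_map]
      exact fun x hx => LSPoset.exists_label_eq.2 ((h1.mem_iff x).1 hx)
    obtain ⟨w, rfl⟩ := this
    exact ⟨w, ⟨isLabelWord_map_label.1 h1, h2⟩, rfl⟩

/-- The list of all words of labels of linear extensions of `P_k`. -/
def labelWords : ℕ → List (List ℕ)
  | 0 => [[]]
  | k + 1 => (((labelWords k).flatMap (insertions [3 * k + 1])).flatMap
      (insertions [3 * k + 3])).map (· ++ [3 * k + 2])

/-- The point `3k+2` is the maximum of `P_{k+1}`, hence last, while `3k+1` and `3k+3` are minimal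
and lie below nothing else, hence free. Inserting `3k+1` before `3k+3` makes each inserted letter
the largest present. -/
theorem isLabelWord_succ {k : ℕ} {u : List ℕ} : IsLabelWord (k + 1) u ↔
    ∃ w, IsLabelWord k w ∧ ∃ v ∈ insertions [3 * k + 1] w,
      ∃ t ∈ insertions [3 * k + 3] v, t ++ [3 * k + 2] = u := by
  simp only [mem_insertions]
  constructor
  · rintro ⟨h1, h2, h3⟩
    obtain ⟨t, q, rfl⟩ := List.append_of_mem ((h2 (3 * k + 2)).2 (by omega))
    -- A letter after `3k+2` would have to exceed `3k+3`.
    have hq : q = [] := by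
      refine List.eq_nil_iff_forall_not_mem.2 fun x hx => ?_
      have hx' := (h2 x).1 (by simp [hx])
      have := (List.pairwise_cons.1 (List.pairwise_append.1 h3).2.1).1 x hx (by omega)
      omega
    subst hq
    have hc : 3 * k + 3 ∈ t := by simpa using (h2 (3 * k + 3)).2 (by omega)
    obtain ⟨p, q, rfl⟩ := List.append_of_mem hc
    have ha : 3 * k + 1 ∈ p ++ q := by simpa using (h2 (3 * k + 1)).2 (by omega)
    obtain ⟨p', q', hpq⟩ := List.append_of_mem ha
    have hs : List.Sublist (p' ++ q') (p ++ (3 * k + 3) :: q ++ [3 * k + 2]) := by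
      refine ((List.Sublist.refl p').append (List.sublist_cons_self (3 * k + 1) q')).trans ?_
      rw [← hpq]
      exact ((List.Sublist.refl p).append (List.sublist_cons_self _ q)).trans
        (List.sublist_append_left _ _)
    have hperm : (p ++ (3 * k + 3) :: q ++ [3 * k + 2]).Perm
        ((3 * k + 2) :: (3 * k + 3) :: (3 * k + 1) :: (p' ++ q')) := by
      refine (List.perm_append_singleton _ _).trans (List.Perm.cons _ ?_)
      refine List.perm_middle.trans (List.Perm.cons _ ?_)
      rw [hpq]
      exact List.perm_middle
    refine ⟨p' ++ q', ⟨h1.sublist hs, fun x => ?_, h3.sublist hs⟩, _, ⟨p', q', rfl, rfl⟩, _,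
      ⟨p, q, by simp [hpq], rfl⟩, by simp⟩
    have hn := hperm.nodup_iff.1 h1
    have hm := h2 x
    rw [hperm.mem_iff] at hm
    simp only [List.nodup_cons, List.mem_cons, not_or] at hn hm
    constructor
    · intro hx
      have := hm.1 (by tauto)
      have e1 := ne_of_mem_of_not_mem hx hn.1.2.2
      have e2 := ne_of_mem_of_not_mem hx hn.2.1.2
      have e3 := ne_of_mem_of_not_mem hx hn.2.2.1
      omega
    · intro hx
      rcases hm.2 (by omega) with h | h | h | h
      · omega
      · omega
      · omega
      · exact h
  · rintro ⟨_, ⟨h1, h2, h3⟩, _, ⟨p', q', rfl, rfl⟩, _, ⟨p, q, hpq, rfl⟩, rfl⟩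
    have hperm : (p ++ [3 * k + 3] ++ q ++ [3 * k + 2]).Perm
        ((3 * k + 2) :: (3 * k + 3) :: (3 * k + 1) :: (p' ++ q')) := by
      refine (List.perm_append_singleton _ _).trans (List.Perm.cons _ ?_)
      rw [List.append_assoc]
      refine List.perm_middle.trans (List.Perm.cons _ ?_)
      change (p ++ q).Perm _
      rw [← hpq, List.append_assoc]
      exact List.perm_middle
    have hb : ∀ x ∈ p ++ q, x ≤ 3 * k + 1 := fun x hx => by
      rw [← hpq, List.append_assoc, List.mem_append, List.mem_append, List.mem_singleton] at hx
      have := h2 x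
      rw [List.mem_append] at this
      rcases hx with hx | hx | hx
      · have := this.1 (Or.inl hx); omega
      · omega
      · have := this.1 (Or.inr hx); omega
    have hpq' : (p ++ q).Pairwise fun a b => a % 3 = 2 → a + 1 < b := by
      rw [← hpq]
      rw [List.append_assoc, List.pairwise_append, List.pairwise_append]
      rw [List.pairwise_append] at h3
      refine ⟨h3.1, ⟨List.pairwise_singleton _ _, h3.2.1, ?_⟩, ?_⟩
      · simp only [List.mem_singleton, forall_eq]
        omega
      · intro a ha b hb
        rw [List.singleton_append, List.mem_cons] at hb
        have := (h2 a).1 (by simp [ha])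
        rcases hb with rfl | hb
        · omega
        · exact h3.2.2 a ha b hb
    refine ⟨?_, fun x => ?_, ?_⟩
    · rw [hperm.nodup_iff]
      simp only [List.nodup_cons, List.mem_cons, h2, not_or]
      exact ⟨by omega, by omega, by omega, h1⟩
    · rw [hperm.mem_iff]
      simp only [List.mem_cons, h2]
      omega
    · rw [List.pairwise_append] at hpq'
      have hbp : ∀ x ∈ p, x ≤ 3 * k + 1 := fun x hx => hb x (List.mem_append_left _ hx)
      have hbq : ∀ x ∈ q, x ≤ 3 * k + 1 := fun x hx => hb x (List.mem_append_right _ hx)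
      simp only [List.append_assoc, List.pairwise_append, List.pairwise_singleton,
        List.mem_append, List.mem_singleton]
      refine ⟨hpq'.1, ⟨trivial, ⟨hpq'.2.1, trivial, ?_⟩, ?_⟩, ?_⟩
      · rintro a ha b rfl
        have := hbq a ha
        omega
      · rintro a rfl b hb
        omega
      · rintro a ha b (rfl | hb | rfl)
        · have := hbp a ha
          omega
        · exact hpq'.2.2 a ha b hb
        · have := hbp a ha
          omega

theorem mem_labelWords {k : ℕ} {w : List ℕ} : w ∈ labelWords k ↔ IsLabelWord k w := by
  induction k generalizing w with
  | zero =>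
    rw [labelWords, List.mem_singleton]
    constructor
    · rintro rfl
      exact ⟨List.nodup_nil, by simp; omega, List.Pairwise.nil⟩
    · intro h
      refine List.eq_nil_iff_forall_not_mem.2 fun x hx => ?_
      have := (h.mem_iff x).1 hx
      omega
  | succ k ih =>
    rw [isLabelWord_succ]
    simp only [labelWords, List.mem_map, List.mem_flatMap, ih]
    constructor
    · rintro ⟨t, ⟨v, ⟨w, hw, hv⟩, ht⟩, rfl⟩
      exact ⟨w, hw, v, hv, t, ht, rfl⟩
    · rintro ⟨w, hw, v, hv, t, ht, rfl⟩
      exact ⟨t, ⟨v, ⟨w, hw, hv⟩, ht⟩, rfl⟩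

theorem le_of_mem_insertions {k : ℕ} {v w : List ℕ} (hw : w ∈ labelWords k)
    (hv : v ∈ insertions [3 * k + 1] w) {x : ℕ} (hx : x ∈ v) : x ≤ 3 * k + 1 := by
  obtain ⟨p, q, rfl, rfl⟩ := mem_insertions.1 hv
  have := (mem_labelWords.1 hw).mem_iff x
  simp only [List.mem_append, List.mem_singleton] at this hx
  rcases hx with (hx | hx) | hx
  · have := this.1 (Or.inl hx)
    omega
  · exact hx.le
  · have := this.1 (Or.inr hx)
    omega

theorem nodup_labelWords (k : ℕ) : (labelWords k).Nodup := by
  induction k with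
  | zero => simp [labelWords]
  | succ k ih =>
    refine List.Nodup.map (List.append_left_injective _) ?_
    refine nodup_flatMap_insertions (by simp) (nodup_flatMap_insertions (by simp) ih ?_) ?_
    · intro w hw h
      have := ((mem_labelWords.1 hw).mem_iff _).1 h
      omega
    · intro v hv h
      obtain ⟨w, hw, hv⟩ := List.mem_flatMap.1 hv
      have := le_of_mem_insertions hw hv h
      omega

theorem IsLabelWord.length_eq {k : ℕ} {w : List ℕ} (h : IsLabelWord k w) : w.length = 3 * k := by
  rw [← List.toFinset_card_of_nodup h.nodup]
  have : w.toFinset = Finset.Icc 1 (3 * k) := by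
    ext x
    rw [List.mem_toFinset, h.mem_iff, Finset.mem_Icc]
  rw [this, Nat.card_Icc, Nat.add_sub_cancel]

variable {R : Type*} [CommRing R]

/-- All gaps of `w ++ [a]` are counted, and the one after `a` is subtracted; an insertion there
leaves the descent number at `des w`. -/
theorem sum_des_insertions_concat (φ : ℕ → R) (a c : ℕ) (w : List ℕ) (hac : a < c)
    (h : ∀ x ∈ w, x ≤ a) :
    ((insertions [c] w).map fun u => φ (des (u ++ [a]))).sum =
      des w * φ (des w) + (w.length + 1 - des w : R) * φ (des w + 1) := by
  have hwa : ∀ x ∈ w ++ [a], x ≤ a := by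
    simpa [or_imp, forall_and] using h
  have hc : c ∉ w ++ [a] := fun hc => by
    have := hwa c hc
    omega
  have h1 := sum_insertions_concat [c] w a fun u => φ (des u)
  have h2 := sum_des_insertions φ 0 c (w ++ [a]) fun x hx => (hwa x hx).trans hac.le
  rw [List.count_eq_zero_of_not_mem hc, des_concat h] at h2
  rw [des_concat (fun x hx => (hwa x hx).trans hac.le), des_concat h] at h1
  rw [← sub_eq_iff_eq_add] at h1
  rw [← h1]
  change ((insertions (List.replicate (0 + 1) c) (w ++ [a])).map _).sum - _ = _
  rw [h2, List.length_append, List.length_singleton]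
  push_cast
  ring

theorem sum_map_flatMap {α β : Type*} (L : List α) (g : α → List β) (f : β → R) :
    ((L.flatMap g).map f).sum = (L.map fun x => ((g x).map f).sum).sum := by
  rw [List.map_flatMap, List.flatMap, List.sum_flatten, List.map_map]
  rfl

theorem sum_labelWords_succ (k : ℕ) (φ : ℕ → R) :
    ((labelWords (k + 1)).map fun w => φ (des w)).sum =
      ((labelWords k).map fun w => descentOperator k φ (des w)).sum := by
  rw [labelWords, List.map_map, sum_map_flatMap, sum_map_flatMap]
  refine congrArg List.sum (List.map_congr_left fun w hw => ?_)
  have hw' := mem_labelWords.1 hw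
  have hc : 3 * k + 1 ∉ w := fun h => by
    have := (hw'.mem_iff _).1 h
    omega
  have h1 : ∀ v ∈ insertions [3 * k + 1] w,
      ((insertions [3 * k + 3] v).map ((fun w => φ (des w)) ∘ (· ++ [3 * k + 2]))).sum =
        (des v * φ (des v) + (3 * k + 2 - des v : R) * φ (des v + 1)) := fun v hv => by
    refine (sum_des_insertions_concat φ (3 * k + 2) (3 * k + 3) v (by omega) fun x hx =>
      (le_of_mem_insertions hw hv hx).trans (by omega)).trans ?_
    have hl : v.length = 3 * k + 1 := by
      obtain ⟨p, q, rfl, rfl⟩ := mem_insertions.1 hv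
      have := hw'.length_eq
      simp only [List.length_append, List.length_singleton] at this ⊢
      omega
    rw [hl]
    push_cast
    ring
  rw [List.map_congr_left h1]
  refine (sum_des_insertions (fun d => (d * φ d + (3 * k + 2 - d : R) * φ (d + 1))) 0 (3 * k + 1) w
    fun x hx => ?_).trans ?_
  · have := (hw'.mem_iff x).1 hx
    omega
  · rw [List.count_eq_zero_of_not_mem hc, hw'.length_eq, descentOperator]
    push_cast
    ring

end LinearExtensions

/-! ### Legendre–Stirling permutations -/

section Permutations

/-- Phrased through sublists, the condition visibly passes to subwords, so it survives deletion of
letters. -/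
theorem stirlingCondition_iff {α : Type*} [LT α] {w : List α} :
    StirlingCondition w ↔ ∀ x y, [x, y, x].Sublist w → x < y := by
  constructor
  · intro h x y hs
    obtain ⟨f, hf⟩ := List.sublist_iff_exists_fin_orderEmbedding_get_eq.1 hs
    have h0 := hf ⟨0, by simp⟩
    have h1 := hf ⟨1, by simp⟩
    have h2 := hf ⟨2, by simp⟩
    simp only [List.get_eq_getElem, List.getElem_cons_zero, List.getElem_cons_succ] at h0 h1 h2
    have := h (f ⟨0, by simp⟩) (f ⟨1, by simp⟩) (f ⟨2, by simp⟩) (f.lt_iff_lt.2 (by simp))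
      (f.lt_iff_lt.2 (by simp)) (by rw [List.get_eq_getElem, List.get_eq_getElem, ← h0, ← h2])
    rwa [List.get_eq_getElem, List.get_eq_getElem, ← h0, ← h1] at this
  · intro h u v t huv hvt hut
    refine h _ _ ?_
    have hs : (List.map (fun i : Fin w.length => w[i]) [u, v, t]).Sublist w := by
      refine List.map_getElem_sublist ?_
      simp [huv, hvt, huv.trans hvt]
    rw [List.map_cons, List.map_cons, List.map_cons, List.map_nil] at hs
    change [w.get u, w.get v, w.get t].Sublist w at hs
    rwa [← hut] at hs

instance : DecidableEq Letter := fun x y =>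
  decidable_of_iff (x.val = y.val ∧ x.barred = y.barred) Letter.ext_iff.symm

theorem M_succ (k : ℕ) : M (k + 1) = {⟨k + 1, false⟩, ⟨k + 1, false⟩, ⟨k + 1, true⟩} + M k := by
  rw [M, Finset.sum_Icc_succ_top (by omega), add_comm]
  rfl

theorem val_le_of_mem_M {k : ℕ} {x : Letter} (h : x ∈ M k) : x.val ≤ k := by
  simp only [M, Multiset.mem_sum, Finset.mem_Icc, Multiset.insert_eq_cons, Multiset.mem_cons,
    Multiset.mem_singleton] at h
  obtain ⟨m, hm, rfl | rfl | rfl⟩ := h <;> exact hm.2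

theorem card_M (k : ℕ) : (M k).card = 3 * k := by
  induction k with
  | zero => rfl
  | succ k ih =>
    rw [M_succ, Multiset.card_add, ih]
    simp
    ring

theorem count_M_succ (k : ℕ) (b : Bool) : (M (k + 1)).count ⟨k + 1, b⟩ = if b then 1 else 2 := by
  have h : (⟨k + 1, b⟩ : Letter) ∉ M k := fun h => by
    have := val_le_of_mem_M h
    simp at this
  rw [M_succ, Multiset.count_add, Multiset.count_eq_zero_of_notMem h]
  cases b <;> simp

/-- No letter exceeds `k+1`, so the two unbarred copies must be adjacent; the single barred letter
is otherwise unrestricted. Conversely, a largest letter between two equal smaller ones does no harm.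
-/
theorem isLegendreStirlingPerm_succ {k : ℕ} {u : List Letter} : IsLegendreStirlingPerm (k + 1) u ↔
    ∃ w, IsLegendreStirlingPerm k w ∧ ∃ v ∈ insertions [⟨k + 1, true⟩] w,
      u ∈ insertions [⟨k + 1, false⟩, ⟨k + 1, false⟩] v := by
  simp only [mem_insertions]
  have hcount : ∀ {u : List Letter}, (u : Multiset Letter) = M (k + 1) → ∀ b,
      u.count ⟨k + 1, b⟩ = if b then 1 else 2 := fun h b => by
    rw [← count_M_succ, ← h, Multiset.coe_count]
  have hcoe : ∀ p q v₁ v₂ : List Letter, p ++ [⟨k + 1, true⟩] ++ q = v₁ ++ v₂ →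
      ((v₁ ++ [⟨k + 1, false⟩, ⟨k + 1, false⟩] ++ v₂ : List Letter) : Multiset Letter) =
        {⟨k + 1, false⟩, ⟨k + 1, false⟩, ⟨k + 1, true⟩} + ((p ++ q : List Letter) :) := by
    intro p q v₁ v₂ h
    refine Multiset.coe_eq_coe.2 (?_ : List.Perm _ ([⟨k + 1, false⟩, ⟨k + 1, false⟩] ++
      ⟨k + 1, true⟩ :: (p ++ q)))
    rw [List.append_assoc]
    refine List.perm_append_comm_assoc _ _ _ |>.trans (List.Perm.append_left _ ?_)
    rw [← h, List.append_assoc]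
    exact List.perm_middle
  constructor
  · rintro ⟨h1, h2⟩
    rw [stirlingCondition_iff] at h2
    have hmem : (⟨k + 1, false⟩ : Letter) ∈ u := by
      rw [← List.count_pos_iff, hcount h1]
      simp
    obtain ⟨v₁, t, rfl, hv₁⟩ := List.eq_append_cons_of_mem hmem
    have ht : (⟨k + 1, false⟩ : Letter) ∈ t := by
      have := hcount h1 false
      rw [List.count_append, List.count_eq_zero_of_not_mem hv₁, List.count_cons_self] at this
      rw [← List.count_pos_iff]
      simp at this
      omega
    obtain ⟨t₁, v₂, rfl⟩ := List.append_of_mem ht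
    have ht₁ : t₁ = [] := by
      refine List.eq_nil_iff_forall_not_mem.2 fun y hy => ?_
      have h3 : (⟨k + 1, false⟩ : Letter) < y := by
        refine h2 _ _ (List.Sublist.trans ?_ (List.sublist_append_right _ _))
        exact ((List.singleton_sublist.2 hy).append
          (List.singleton_sublist.2 List.mem_cons_self)).cons_cons _
      have h4 : y ∈ M (k + 1) := by
        rw [← h1]
        simp [hy]
      have h5 : k + 1 < y.val := h3
      have := val_le_of_mem_M h4
      omega
    subst ht₁
    have hb : (⟨k + 1, true⟩ : Letter) ∈ v₁ ++ v₂ := by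
      have : (⟨k + 1, true⟩ : Letter) ∈ v₁ ++ ⟨k + 1, false⟩ :: ([] ++ ⟨k + 1, false⟩ :: v₂) := by
        rw [← List.count_pos_iff, hcount h1]
        simp
      simpa using this
    obtain ⟨p, q, hpq⟩ := List.append_of_mem hb
    refine ⟨p ++ q, ⟨?_, ?_⟩, _, ⟨p, q, rfl, rfl⟩, v₁, v₂, by simp [hpq], by simp⟩
    · have := hcoe p q v₁ v₂ (by simp [hpq])
      rw [M_succ] at h1
      refine add_left_cancel ((this.symm.trans ?_).trans h1)
      simp
    · rw [stirlingCondition_iff]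
      refine fun x y hxy => h2 x y (hxy.trans ?_)
      refine ((List.Sublist.refl p).append (List.sublist_cons_self ⟨k + 1, true⟩ q)).trans ?_
      rw [← hpq]
      exact (List.Sublist.refl _).append
        ((List.sublist_cons_self _ _).trans (List.sublist_cons_self _ _))
  · rintro ⟨_, ⟨h1, h2⟩, _, ⟨p, q, rfl, rfl⟩, v₁, v₂, hpq, rfl⟩
    have hM : ((v₁ ++ [⟨k + 1, false⟩, ⟨k + 1, false⟩] ++ v₂ : List Letter) : Multiset Letter) =
        M (k + 1) := by
      rw [hcoe p q v₁ v₂ hpq, h1, M_succ]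
    refine ⟨hM, ?_⟩
    rw [stirlingCondition_iff] at h2 ⊢
    have hle : ∀ x ∈ p ++ q, x.val ≤ k := fun x hx => val_le_of_mem_M (by rwa [← h1])
    have hv : (⟨k + 1, false⟩ : Letter) ∉ v₁ ++ v₂ := by
      rw [← hpq]
      intro h
      have := hle ⟨k + 1, false⟩
      simp at h this
      tauto
    rw [List.mem_append, not_or] at hv
    intro x y hs
    have hxM : x.val ≤ k + 1 := val_le_of_mem_M (by
      rw [← hM]
      exact hs.subset (by simp))
    have hyM : y.val ≤ k + 1 := val_le_of_mem_M (by
      rw [← hM]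
      exact hs.subset (by simp))
    rcases hxM.lt_or_eq with hx | hx
    · rcases hyM.lt_or_eq with hy | hy
      -- Discarding the letters of value `k+1` moves the pattern into the old word.
      · have hf := hs.filter fun z : Letter => decide (z.val ≤ k)
        have e1 : ([x, y, x] : List Letter).filter (fun z => decide (z.val ≤ k)) = [x, y, x] := by
          have hx' : x.val ≤ k := by omega
          have hy' : y.val ≤ k := by omega
          simp [hx', hy']
        have e2 : (v₁ ++ [⟨k + 1, false⟩, ⟨k + 1, false⟩] ++ v₂ : List Letter).filter
            (fun z => decide (z.val ≤ k)) = p ++ q := by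
          have e3 := congrArg (List.filter fun z : Letter => decide (z.val ≤ k)) hpq
          have e4 : (p ++ q).filter (fun z : Letter => decide (z.val ≤ k)) = p ++ q :=
            List.filter_eq_self.2 fun z hz => by simpa using hle z hz
          rw [← e4]
          simpa using e3.symm
        rw [e1, e2] at hf
        exact h2 x y hf
      · change x.val < y.val
        omega
    -- The outer letter of a pattern cannot have value `k+1`: the barred symbol occurs once, and the
    -- two unbarred ones have nothing between them.
    · exfalso
      have hc := hs.count_le x
      obtain ⟨m, b⟩ := x
      obtain rfl : m = k + 1 := hx
      rw [hcount hM] at hc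
      cases b
      · by_cases hy : y = ⟨k + 1, false⟩
        · subst hy
          simp at hc
        · rw [List.append_assoc, List.sublist_append_iff] at hs
          obtain ⟨l₁, l₂, hl, hs₁, hs₂⟩ := hs
          rcases l₁ with _ | ⟨z, l₁⟩
          · rw [List.nil_append] at hl
            subst hl
            have hs₃ := List.cons_sublist_cons.1 hs₂
            cases hs₃ with
            | cons _ hs₃ => exact hv.2 (hs₃.subset (by simp))
            | cons_cons _ _ => exact hy rfl
          · obtain ⟨rfl, -⟩ := List.cons.inj hl
            exact hv.1 (hs₁.subset (by simp))
      · simp [List.count_cons] at hc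

/-- The list of all Legendre-Stirling permutations of `M_k`. -/
def legendreStirlingPerms : ℕ → List (List Letter)
  | 0 => [[]]
  | k + 1 => ((legendreStirlingPerms k).flatMap (insertions [⟨k + 1, true⟩])).flatMap
      (insertions [⟨k + 1, false⟩, ⟨k + 1, false⟩])

theorem mem_legendreStirlingPerms {k : ℕ} {w : List Letter} :
    w ∈ legendreStirlingPerms k ↔ IsLegendreStirlingPerm k w := by
  induction k generalizing w with
  | zero =>
    rw [legendreStirlingPerms, List.mem_singleton]
    constructor
    · rintro rfl
      exact ⟨rfl, fun u => u.elim0⟩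
    · intro h
      exact (Multiset.coe_eq_zero _).1 h.1
  | succ k ih =>
    rw [isLegendreStirlingPerm_succ]
    simp only [legendreStirlingPerms, List.mem_flatMap, ih]
    constructor
    · rintro ⟨v, ⟨w, hw, hv⟩, ht⟩
      exact ⟨w, hw, v, hv, ht⟩
    · rintro ⟨w, hw, v, hv, ht⟩
      exact ⟨v, ⟨w, hw, hv⟩, ht⟩

theorem val_le_of_mem {k : ℕ} {w : List Letter} (hw : w ∈ legendreStirlingPerms k) {x : Letter}
    (hx : x ∈ w) : x.val ≤ k :=
  val_le_of_mem_M (by rwa [← (mem_legendreStirlingPerms.1 hw).1])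

theorem nodup_legendreStirlingPerms (k : ℕ) : (legendreStirlingPerms k).Nodup := by
  induction k with
  | zero => simp [legendreStirlingPerms]
  | succ k ih =>
    refine nodup_flatMap_insertions (by simp) (nodup_flatMap_insertions (by simp) ih ?_) ?_
    · intro w hw h
      have := val_le_of_mem hw h
      simp at this
    · intro v hv h
      obtain ⟨w, hw, hv⟩ := List.mem_flatMap.1 hv
      obtain ⟨p, q, rfl, rfl⟩ := mem_insertions.1 hv
      have := val_le_of_mem hw (x := ⟨k + 1, false⟩)
      simp at this h
      tauto

variable {R : Type*} [CommRing R]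

/-- Descents see only values, so the result for words in `ℕ` transfers, with `m` and `m̄` both
counted as copies of `m`. -/
theorem sum_des_insertions_letter (φ : ℕ → R) (r : ℕ) (c : Letter) (w : List Letter)
    (h : ∀ x ∈ w, x.val ≤ c.val) :
    ((insertions (List.replicate (r + 1) c) w).map fun u => φ (des u)).sum =
      (des w + 1 + (w.map Letter.val).count c.val : R) * φ (des w) +
        (w.length - des w - (w.map Letter.val).count c.val : R) * φ (des w + 1) := by
  have hd : ∀ w : List Letter, des (w.map Letter.val) = des w := des_map fun _ _ => Iff.rfl
  have := sum_des_insertions φ r c.val (w.map Letter.val) (by simpa using h)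
  rw [← List.map_replicate, ← map_insertions, List.map_map, hd, List.length_map] at this
  rw [← this]
  refine congrArg List.sum (List.map_congr_left fun u _ => ?_)
  rw [Function.comp_apply, hd]

/-- With `e = des w + 1`, the two insertions have no-descent weights `e`, then `e + 1`; for linear
extensions they are `e + 1`, then `e`. The single steps differ, yet the composites coincide. The
barred letter already present supplies the extra descent-free gap. -/
theorem sum_legendreStirlingPerms_succ (k : ℕ) (φ : ℕ → R) :
    ((legendreStirlingPerms (k + 1)).map fun w => φ (des w + 1)).sum =
      ((legendreStirlingPerms k).map fun w => descentOperator k φ (des w + 1)).sum := by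
  rw [legendreStirlingPerms, sum_map_flatMap, sum_map_flatMap]
  refine congrArg List.sum (List.map_congr_left fun w hw => ?_)
  have hl : w.length = 3 * k := by
    rw [← card_M, ← (mem_legendreStirlingPerms.1 hw).1, Multiset.coe_card]
  have hc : k + 1 ∉ w.map Letter.val := fun h => by
    obtain ⟨x, hx, h⟩ := List.mem_map.1 h
    have := val_le_of_mem hw hx
    omega
  have h1 : ∀ v ∈ insertions [⟨k + 1, true⟩] w,
      ((insertions [⟨k + 1, false⟩, ⟨k + 1, false⟩] v).map fun u => φ (des u + 1)).sum =
        (des v + 2) * φ (des v + 1) + (3 * k - des v : R) * φ (des v + 2) := fun v hv => by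
    obtain ⟨p, q, rfl, rfl⟩ := mem_insertions.1 hv
    refine (sum_des_insertions_letter (fun d => φ (d + 1)) 1 ⟨k + 1, false⟩ _ fun x hx => ?_).trans ?_
    · have := val_le_of_mem hw (x := x)
      simp only [List.mem_append, List.mem_singleton] at this hx
      rcases hx with (hx | rfl) | hx
      · exact (this (Or.inl hx)).trans (by simp)
      · exact le_rfl
      · exact (this (Or.inr hx)).trans (by simp)
    · rw [List.map_append, List.mem_append, not_or] at hc
      have hl' : (p.length : R) + q.length = 3 * k := by
        rw [List.length_append] at hl
        exact_mod_cast congrArg (Nat.cast : ℕ → R) hl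
      simp only [List.map_append, List.count_append, List.count_eq_zero_of_not_mem hc.1,
        List.count_eq_zero_of_not_mem hc.2, List.length_append, List.map_cons, List.map_nil,
        List.count_singleton_self, List.length_singleton]
      push_cast
      linear_combination φ (des (p ++ [⟨k + 1, true⟩] ++ q) + 2) * hl'
  rw [List.map_congr_left h1]
  refine (sum_des_insertions_letter (fun d => (d + 2) * φ (d + 1) + (3 * k - d : R) * φ (d + 2)) 0
    ⟨k + 1, true⟩ w fun x hx => (val_le_of_mem hw hx).trans (by simp)).trans ?_
  rw [List.count_eq_zero_of_not_mem hc, hl, descentOperator]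
  push_cast
  ring_nf

theorem sum_labelWords_eq (k : ℕ) (φ : ℕ → R) :
    ((labelWords (k + 1)).map fun w => φ (des w)).sum =
      ((legendreStirlingPerms (k + 1)).map fun w => φ (des w + 1)).sum := by
  induction k generalizing φ with
  | zero =>
    rw [sum_labelWords_succ, sum_legendreStirlingPerms_succ]
    -- The shift by one fails for the empty word, but `descentOperator 0 φ` takes the value `2 * φ
    -- 1` at both `0` and `1`.
    simp [labelWords, legendreStirlingPerms, descentOperator, des, one_add_one_eq_two]
  | succ k ih =>
    rw [sum_labelWords_succ, sum_legendreStirlingPerms_succ, ih]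

end Permutations

/-! ### The generating function of the Legendre–Stirling numbers -/

section GeneratingFunction

open PowerSeries

/-- This is the triangular recurrence read coefficientwise: the weight `(n+1)(n+2)` is what two
derivatives of `t^(n+2)` produce. -/
theorem one_sub_X_mul_mk_legendreStirling (k : ℕ) :
    (1 - X) * (mk fun n : ℕ => legendreStirling (n + (k + 1)) n) =
      X * derivative ℤ (derivative ℤ (X * mk fun n : ℕ => legendreStirling (n + k) n)) := by
  ext n
  rcases n with _ | n
  · simp [sub_mul, legendreStirling, jacobiStirling]
  · rw [sub_mul, one_mul, map_sub, coeff_succ_X_mul, coeff_succ_X_mul, coeff_derivative,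
      coeff_derivative, coeff_succ_X_mul, coeff_mk, coeff_mk, coeff_mk]
    have h : legendreStirling (n + 1 + (k + 1)) (n + 1) = legendreStirling (n + (k + 1)) n +
        ((n + 1 : ℕ) : ℤ) * (((n + 1 : ℕ) : ℤ) + 1) * legendreStirling (n + 1 + k) (n + 1) := by
      rw [legendreStirling, ← add_assoc, jacobiStirling, show n + 1 + k = n + (k + 1) by ring]
      rfl
    rw [h]
    push_cast
    ring

/-- The second derivative of `G / (1-t)^N` for `G = H (1-t)^N`, with denominators cleared. -/
theorem derivative_derivative_mul_one_sub_X_pow (N : ℕ) (H : ℤ⟦X⟧) :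
    derivative ℤ (derivative ℤ H) * (1 - X) ^ (N + 2) =
      (1 - X) ^ 2 * derivative ℤ (derivative ℤ (H * (1 - X) ^ N)) +
        2 * (N : ℤ⟦X⟧) * ((1 - X) * derivative ℤ (H * (1 - X) ^ N)) +
        (N : ℤ⟦X⟧) * ((N : ℤ⟦X⟧) + 1) * (H * (1 - X) ^ N) := by
  have hu : derivative ℤ (1 - X : ℤ⟦X⟧) = -1 := by
    rw [map_sub, derivative_one, derivative_X, zero_sub]
  have hpow : ∀ m : ℕ, (1 - X) * derivative ℤ ((1 - X : ℤ⟦X⟧) ^ m) = -(m : ℤ⟦X⟧) * (1 - X) ^ m := by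
    intro m
    rw [derivative_pow, hu]
    rcases m with _ | m
    · simp
    · rw [Nat.add_sub_cancel]
      ring
  have hmul : ∀ F G : ℤ⟦X⟧, derivative ℤ (F * G) = F * derivative ℤ G + G * derivative ℤ F :=
    fun F G => by simp [Derivation.leibniz]
  have h1 : (1 - X) * derivative ℤ (H * (1 - X) ^ N) =
      derivative ℤ H * (1 - X) ^ (N + 1) - (N : ℤ⟦X⟧) * (H * (1 - X) ^ N) := by
    rw [hmul]
    linear_combination H * hpow N
  have h2 := congrArg (derivative ℤ) h1
  rw [hmul (1 - X), hu, map_sub, hmul (derivative ℤ H), hmul (N : ℤ⟦X⟧), show derivative ℤ (N : ℤ⟦X⟧) = 0 by simp] at h2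
  have h3 := hpow (N + 1)
  push_cast at h3
  linear_combination (X - 1) * h2 - derivative ℤ H * h3 - ((N : ℤ⟦X⟧) + 1) * h1

/-- The operator on power series which corresponds to `F ↦ t (t F)''` for the numerator `P` of
`F = P / (1 - t) ^ N`. -/
noncomputable def numeratorOperator (N : ℕ) : ℤ⟦X⟧ →+ ℤ⟦X⟧ where
  toFun P := X * ((1 - X) ^ 2 * derivative ℤ (derivative ℤ (X * P)) +
    2 * (N : ℤ⟦X⟧) * ((1 - X) * derivative ℤ (X * P)) + (N : ℤ⟦X⟧) * ((N : ℤ⟦X⟧) + 1) * (X * P))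
  map_zero' := by simp
  map_add' P Q := by
    simp only [mul_add, map_add]
    ring

/-- The link between analysis and combinatorics: for `N = 3k+1` the coefficients of `t^j`,
`t^(j+1)`, `t^(j+2)` are the weights of the two insertions. -/
theorem numeratorOperator_X_pow (k j : ℕ) :
    numeratorOperator (3 * k + 1) (X ^ j) = descentOperator k (fun j => (X : ℤ⟦X⟧) ^ j) j := by
  have h1 : derivative ℤ (X * X ^ j : ℤ⟦X⟧) = ((j : ℤ⟦X⟧) + 1) * X ^ j := by
    rw [← pow_succ', derivative_pow, derivative_X, Nat.add_sub_cancel]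
    push_cast
    ring
  have h2 : X * derivative ℤ (((j : ℤ⟦X⟧) + 1) * X ^ j) = ((j : ℤ⟦X⟧) + 1) * (j : ℤ⟦X⟧) * X ^ j := by
    have h : derivative ℤ ((j : ℤ⟦X⟧) + 1) = 0 := by simp
    rw [Derivation.leibniz, h, smul_zero, add_zero, derivative_pow, derivative_X, smul_eq_mul]
    rcases j with _ | j
    · simp
    · rw [Nat.add_sub_cancel]
      push_cast
      ring
  rw [numeratorOperator, descentOperator]
  simp only [AddMonoidHom.coe_mk, ZeroHom.coe_mk, h1]
  push_cast
  linear_combination (1 - X) ^ 2 * h2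

theorem mk_legendreStirling_mul_one_sub_X_pow (k : ℕ) :
    (mk fun n : ℕ => legendreStirling (n + k) n) * (1 - X) ^ (3 * k + 1) =
      ((labelWords k).map fun w => (X : ℤ⟦X⟧) ^ des w).sum := by
  induction k with
  | zero =>
    have h : ∀ n, legendreStirling n n = 1 := by
      intro n
      induction n with
      | zero => rfl
      | succ n ih =>
        rw [legendreStirling] at ih ⊢
        rw [jacobiStirling, ih, jacobiStirling_eq_zero _ _ _ (by omega), mul_zero, add_zero]
    simp only [add_zero, h, mul_zero, zero_add, pow_one]
    refine Eq.trans ( mk_one_mul_one_sub_eq_one ℤ) ?_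
    simp [labelWords, des]
  | succ k ih =>
    have h := derivative_derivative_mul_one_sub_X_pow (3 * k + 1)
      (X * mk fun n : ℕ => legendreStirling (n + k) n)
    rw [mul_assoc X, ih] at h
    have hop : numeratorOperator (3 * k + 1) ((labelWords k).map fun w => X ^ des w).sum =
        ((labelWords (k + 1)).map fun w => (X : ℤ⟦X⟧) ^ des w).sum := by
      rw [sum_labelWords_succ k fun j => (X : ℤ⟦X⟧) ^ j, map_list_sum, List.map_map]
      simp only [Function.comp_def, numeratorOperator_X_pow]
    rw [← hop, numeratorOperator]
    simp only [AddMonoidHom.coe_mk, ZeroHom.coe_mk]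
    rw [← h]
    linear_combination (1 - X) ^ (3 * k + 3) * one_sub_X_mul_mk_legendreStirling k

end GeneratingFunction

/-! ### From test functions back to the numbers `b k j` -/

section Counting

theorem ncard_eq_sum {α : Type*} {L : List (List α)} (hL : L.Nodup) (p : List α → Prop)
    (hp : ∀ w, w ∈ L ↔ p w) (q : List α → Prop) [DecidablePred q] :
    Set.ncard {w | p w ∧ q w} = (L.map fun w => if q w then 1 else 0).sum := by
  classical
  rw [← List.sum_toFinset _ hL, ← Finset.card_filter, ← Set.ncard_coe_finset]
  congr 1
  ext w
  simp [hp]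

/-- A dual form of the bound of descents by `1` and `2k+1`: `descentOperator` looks at most two
places ahead, so each block raises the upper bound by two. -/
theorem sum_labelWords_eq_zero {R : Type*} [CommRing R] (k : ℕ) (φ : ℕ → R)
    (h : ∀ j, 1 ≤ j → j ≤ 2 * k + 1 → φ j = 0) :
    ((labelWords (k + 1)).map fun w => φ (des w)).sum = 0 := by
  induction k generalizing φ with
  | zero =>
    rw [sum_labelWords_succ]
    simp [labelWords, descentOperator, des, h 1]
  | succ k ih =>
    rw [sum_labelWords_succ]
    refine ih _ fun j h1 h2 => ?_
    rw [descentOperator, h j (by omega) (by omega), h (j + 1) (by omega) (by omega),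
      h (j + 2) (by omega) (by omega)]
    ring

theorem b_eq_sum (k j : ℕ) :
    b k j = ((labelWords k).map fun w => if des w = j then 1 else 0).sum := by
  rw [b_eq_ncard]
  exact ncard_eq_sum (nodup_labelWords k) _ (fun _ => mem_labelWords) _

theorem sum_labelWords_eq_sum_b {R : Type*} [CommRing R] (k : ℕ) (φ : ℕ → R) :
    ((labelWords (k + 1)).map fun w => φ (des w)).sum =
      ∑ j ∈ Finset.Icc 1 (2 * k + 1), b (k + 1) j * φ j := by
  -- The test function minus its truncation to the admissible descent numbers vanishes on that
  -- range.
  have h := sum_labelWords_eq_zero k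
    (fun d => φ d - ∑ j ∈ Finset.Icc 1 (2 * k + 1), (if d = j then 1 else 0) * φ j) fun j h1 h2 => by
      simp [h1, h2]
  simp only [← List.sum_toFinset _ (nodup_labelWords _), Finset.sum_sub_distrib] at h ⊢
  rw [sub_eq_zero.1 h, Finset.sum_comm]
  refine Finset.sum_congr rfl fun j _ => ?_
  rw [b_eq_sum, ← List.sum_toFinset _ (nodup_labelWords _), Nat.cast_sum, Finset.sum_mul]
  simp

end Counting

end LegendreStirling

theorem mainTheorem5 (k : ℕ) (hk : 1 ≤ k) :
    (∀ j : ℕ, 1 ≤ j →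
      LegendreStirling.b k j =
        Set.ncard {π : List LegendreStirling.Letter |
          LegendreStirling.IsLegendreStirlingPerm k π ∧ LegendreStirling.des π = j - 1}) ∧
    (PowerSeries.mk fun n : ℕ => LegendreStirling.legendreStirling (n + k) n) *
        (1 - PowerSeries.X) ^ (3 * k + 1) =
      ∑ j ∈ Finset.Icc 1 (2 * k - 1),
        PowerSeries.C (LegendreStirling.b k j : ℤ) * PowerSeries.X ^ j := by
  obtain ⟨k, rfl⟩ : ∃ m, k = m + 1 := ⟨k - 1, by omega⟩
  refine ⟨fun j hj => ?_, ?_⟩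
  · rw [LegendreStirling.ncard_eq_sum (LegendreStirling.nodup_legendreStirlingPerms (k + 1)) _
      (fun _ => LegendreStirling.mem_legendreStirlingPerms), LegendreStirling.b_eq_sum]
    have h := LegendreStirling.sum_labelWords_eq k fun d => if d = j then (1 : ℤ) else 0
    -- Needs `1 ≤ j`, since the subtraction is truncated.
    have hd : ∀ d, d + 1 = j ↔ d = j - 1 := fun d => by omega
    simp only [hd] at h
    zify
    simpa [Nat.cast_list_sum, Function.comp_def] using h
  · rw [LegendreStirling.mk_legendreStirling_mul_one_sub_X_pow,
      LegendreStirling.sum_labelWords_eq_sum_b k fun j => (PowerSeries.X : PowerSeries ℤ) ^ j]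
    simp [show 2 * (k + 1) - 1 = 2 * k + 1 by omega]
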